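/- All graphs are finite and simple, and isomorphic graphs are identified. For a graph $G$ and a set $U$ of vertices, $G-U$ is obtained by deleting $U$ (and all incident edges), and the contraction $G/U$ is obtained by deleting $U$ and adding a new vertex adjacent to all vertices outside $U$ that have a neighbour in $U$. A graph is $2$-connected if $G-U$ is connected for every vertex set $U$ with $|U|\le 1$, where a graph is connected if any two of its vertices are joined by a path. A cycle $C$ in $G$ is induced if it has no chord, and non-separating if $G-V(C)$ has at most as many connected components as $G$. The contraction $G/\{u,v\}$ of two distinct vertices $u,v$ is admissible if $u$ and $v$ have a common neighbour $w$ such that the path $u,w,v$ is part of an induced non-separating cycle of $G$. A graph $H$ is a bipartite minor of $G$, written $H\le_B G$, if there is a sequence of graphs $H=H_0,H_1,\dots,H_m=G$, $m\ge 0$, such that each $H_i$ with $i<m$ is obtained from $H_{i+1}$ by deleting a vertex, deleting an edge, or performing an admissible contraction. The relation $\le_B$ is a well-quasi-order on a class $\mathcal K$ only if every infinite sequence $x_1,x_2,\dots$ in $\mathcal K$ has indices $i<j$ with $x_i\le_B x_j$. For an integer $k\ge 4$, let $D(k,4,4)$ be the graph obtained from a cycle $C_k$ with consecutive vertices $v_1,v_2,v_3,v_4,\dots$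 and two disjoint $4$-cycles by identifying an edge of the first $4$-cycle with the edge $v_1v_2$ and an edge of the second $4$-cycle with the edge $v_3v_4$. **Theorem.** The bipartite minor relation $\le_B$ is not a well-quasi-order: there are infinite sequences without indices $i<j$ such that $x_i\le_B x_j$ in the class of all graphs, in the class of bipartite graphs, and even in the class of $2$-connected bipartite graphs. More precisely, for every even $k\ge 4$ the graph $D(k,4,4)$ is bipartite and $2$-connected, and for all distinct even $k,k'\ge 4$ we have $D(k,4,4)\not\le_B D(k',4,4)$; hence $\{D(k,4,4) : k\ge 4 \text{ even}\}$ is an infinite antichain for $\le_B$. -/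

import Mathlib

namespace BipMinor

/-- A finite simple graph. -/
structure FinGraph where
  /-- the vertices -/
  V : Type
  /-- there are finitely many vertices -/
  finite : Finite V
  /-- the adjacency structure -/
  graph : SimpleGraph V

/-- The contraction `G / U`: the vertices in `U` are removed, and a new vertex `none` is added,
which is adjacent to all neighbours outside `U` of the vertices in `U`. -/
def contract {V : Type} (G : SimpleGraph V) (U : Set V) : SimpleGraph (Option {x : V // x ∉ U}) where
  Adj
    | some x, some y => G.Adj x y
    | none, some y => ∃ u ∈ U, G.Adj u y
    | some x, none => ∃ u ∈ U, G.Adj u x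
    | none, none => False
  symm := ⟨by
    rintro (_ | x) (_ | y) h
    · exact h
    · exact h
    · exact h
    · exact SimpleGraph.Adj.symm h⟩
  loopless := ⟨by
    rintro (_ | x) h
    · exact h
    · exact G.irrefl h⟩

/-- The closed walk `c` is an induced cycle: a cycle without chords. -/
def IsInducedCycle {V : Type} (G : SimpleGraph V) {a : V} (c : G.Walk a a) : Prop :=
  c.IsCycle ∧ ∀ x ∈ c.support, ∀ y ∈ c.support, G.Adj x y → s(x, y) ∈ c.edges

/-- Deleting the vertices of `c` does not increase the number of connected components. -/
def IsNonSeparating {V : Type} (G : SimpleGraph V) {a : V} (c : G.Walk a a) : Prop :=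
  ENat.card (G.induce {x | x ∉ c.support}).ConnectedComponent ≤ ENat.card G.ConnectedComponent

/-- The contraction of `u` and `v` is admissible: there is a common neighbour `w` such that the
path `u, w, v` is part of an induced non-separating cycle. -/
def IsAdmissible {V : Type} (G : SimpleGraph V) (u v : V) : Prop :=
  u ≠ v ∧ ∃ (w a : V) (c : G.Walk a a), IsInducedCycle G c ∧ IsNonSeparating G c ∧
    s(u, w) ∈ c.edges ∧ s(w, v) ∈ c.edges

/-- Up to isomorphism, `H` is obtained from `G` by deleting one vertex, deleting one edge, or
performing one admissible contraction. -/
def IsStep (H G : FinGraph) : Prop :=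
  (∃ v : G.V, Nonempty (H.graph ≃g G.graph.induce {x | x ≠ v})) ∨
  (∃ e ∈ G.graph.edgeSet, Nonempty (H.graph ≃g G.graph.deleteEdges {e})) ∨
  (∃ u v : G.V, IsAdmissible G.graph u v ∧ Nonempty (H.graph ≃g contract G.graph {u, v}))

/-- `H` is a bipartite minor of `G`: there is a finite sequence of graphs from `H` to `G` in which
each graph is obtained from the next one by one of the three operations. Isomorphic graphs are
identified, so a graph in the sequence may also be replaced by an isomorphic one. -/
def IsBipartiteMinor (H G : FinGraph) : Prop :=
  Relation.ReflTransGen (fun A B : FinGraph => Nonempty (A.graph ≃g B.graph) ∨ IsStep A B) H G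

/-- `G` is `k`-connected: `G - U` is connected for every set `U` of at most `k - 1` vertices
(a graph is connected if any two of its vertices are joined by a path). -/
def IsKConnected {V : Type} (k : ℕ) (G : SimpleGraph V) : Prop :=
  ∀ U : Finset V, U.card < k → (G.induce {x | x ∉ U}).Preconnected

/-- The edges of a dog, each listed in at least one direction. The vertices `0, …, l - 1` of the
snout form a cycle. The ear number `i` is the cycle of length `ears i` that consists of the snout
edge from `2 i` to `2 i + 1` and of `ears i - 2` further vertices, which form a path whose first
vertex is joined to `2 i` and whose last vertex is joined to `2 i + 1`. -/
def dogRel (l : ℕ) {k : ℕ} (ears : Fin k → ℕ) :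
    Fin l ⊕ (Σ i : Fin k, Fin (ears i - 2)) → Fin l ⊕ (Σ i : Fin k, Fin (ears i - 2)) → Prop
  | .inl a, .inl b => (SimpleGraph.cycleGraph l).Adj a b
  | .inl a, .inr x =>
      (a.val = 2 * x.1.val ∧ x.2.val = 0) ∨ (a.val = 2 * x.1.val + 1 ∧ x.2.val + 3 = ears x.1)
  | .inr x, .inr y => x.1 = y.1 ∧ x.2.val + 1 = y.2.val
  | .inr _, .inl _ => False

/-- The dog `D(l, l₁, …, lₖ)` with snout of length `l` and `k` ears of lengths `l₁, …, lₖ`, for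
`3 ≤ l`, `2 * k ≤ l` and `3 ≤ lᵢ`. -/
def dog (l : ℕ) {k : ℕ} (ears : Fin k → ℕ) : FinGraph where
  V := Fin l ⊕ (Σ i : Fin k, Fin (ears i - 2))
  finite := inferInstance
  graph := SimpleGraph.fromRel (dogRel l ears)

end BipMinor

namespace BipMinor

/-! The invariant is the cyclomatic number β = |E| + c - |V|, where c counts connected components.
None of the three operations increases β. For an admissible contraction of u and v this is because
the required common neighbour w makes the edges uw and vw coincide, so the loss of one vertex is
paid for by the loss of at least one edge (`IsStep.cyclomaticNumber_le`).

Every D(k,4,4) has β = 3, independently of k, and every operation applied to it strictly lowers β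
(`IsStep.cyclomaticNumber_lt`). Deleting a vertex or an edge does so by 2-connectedness and minimum
degree two. For a contraction the point is that an induced non-separating cycle must be one of the
two 4-cycle ears: the snout is induced but separates the inner vertices of one ear from those of the
other. Opposite vertices of an ear have two common neighbours, so the contraction loses at least two
edges (`two_le_card_of_isAdmissible`).

Hence a bipartite minor of D(k',4,4) is isomorphic to it or has β < 3. A dog D(k,4,4) below it must
therefore be isomorphic to it, and counting the k + 4 vertices gives k = k'. -/

/-- The cyclomatic number: the number of edges plus the number of connected components minus the
number of vertices. -/
noncomputable def cyclomaticNumber {V : Type*} (G : SimpleGraph V) : ℤ :=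
  Nat.card G.edgeSet + Nat.card G.ConnectedComponent - Nat.card V

theorem cyclomaticNumber_congr {V W : Type*} {G : SimpleGraph V} {H : SimpleGraph W}
    (φ : G ≃g H) : cyclomaticNumber G = cyclomaticNumber H := by
  rw [cyclomaticNumber, cyclomaticNumber, Nat.card_congr φ.mapEdgeSet,
    Nat.card_congr φ.connectedComponentEquiv, Nat.card_congr φ.toEquiv]

/-! ### Cyclomatic number under edge deletion -/

section Reachability

variable {V : Type*} {G : SimpleGraph V}

theorem reachable_induction {P : V → Prop} {a b : V} (h : G.Reachable a b) (ha : P a)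
    (hP : ∀ x y, G.Adj x y → P x → P y) : P b := by
  rw [SimpleGraph.reachable_iff_reflTransGen] at h
  induction h with
  | refl => exact ha
  | tail _ hxy ih => exact hP _ _ hxy ih

/-- A path can be cut at its uses of the edge xy: either xy is avoidable, or a reaches one end and b
the other without it. -/
theorem reachable_deleteEdges_or {x y a b : V} (h : G.Reachable a b) :
    (G.deleteEdges {s(x, y)}).Reachable a b ∨
    ((G.deleteEdges {s(x, y)}).Reachable a x ∧ (G.deleteEdges {s(x, y)}).Reachable y b) ∨
    ((G.deleteEdges {s(x, y)}).Reachable a y ∧ (G.deleteEdges {s(x, y)}).Reachable x b) := by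
  refine reachable_induction (P := fun b ↦ (G.deleteEdges {s(x, y)}).Reachable a b ∨
    ((G.deleteEdges {s(x, y)}).Reachable a x ∧ (G.deleteEdges {s(x, y)}).Reachable y b) ∨
    ((G.deleteEdges {s(x, y)}).Reachable a y ∧ (G.deleteEdges {s(x, y)}).Reachable x b))
    h (Or.inl .rfl) fun c d hcd ih ↦ ?_
  by_cases he : s(c, d) = s(x, y)
  · have hx : (G.deleteEdges {s(x, y)}).Reachable x x := .rfl
    have hy : (G.deleteEdges {s(x, y)}).Reachable y y := .rfl
    rcases Sym2.eq_iff.1 he with ⟨rfl, rfl⟩ | ⟨rfl, rfl⟩ <;> tauto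
  · have hr : (G.deleteEdges {s(x, y)}).Reachable c d :=
      SimpleGraph.Adj.reachable (by simpa [SimpleGraph.deleteEdges_adj, hcd] using he)
    rcases ih with h | ⟨h1, h2⟩ | ⟨h1, h2⟩
    · exact Or.inl (h.trans hr)
    · exact Or.inr (Or.inl ⟨h1, h2.trans hr⟩)
    · exact Or.inr (Or.inr ⟨h1, h2.trans hr⟩)

end Reachability

section EdgeDeletion

variable {V : Type*} [Finite V] {G : SimpleGraph V} {x y : V}

theorem card_edgeSet_deleteEdges (h : G.Adj x y) :
    Nat.card (G.deleteEdges {s(x, y)}).edgeSet + 1 = Nat.card G.edgeSet := by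
  rw [SimpleGraph.edgeSet_deleteEdges]
  exact Set.ncard_sdiff_singleton_add_one (s := G.edgeSet) h

theorem card_connectedComponent_deleteEdges_le :
    Nat.card (G.deleteEdges {s(x, y)}).ConnectedComponent ≤
      Nat.card G.ConnectedComponent + 1 := by
  classical
  set H := G.deleteEdges {s(x, y)} with hH
  have hle : H ≤ G := SimpleGraph.deleteEdges_le _
  -- Only the component of x is singled out: if two components of H merge in G, one of them contains
  -- x.
  let f : H.ConnectedComponent → Option G.ConnectedComponent := fun C ↦
    if C = H.connectedComponentMk x then none
    else some (C.map (SimpleGraph.Hom.ofLE hle))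
  have hf : Function.Injective f := by
    intro C D hCD
    induction C using SimpleGraph.ConnectedComponent.ind with | _ a
    induction D using SimpleGraph.ConnectedComponent.ind with | _ b
    simp only [f] at hCD
    split_ifs at hCD with h1 h2 h2
    · exact h1.trans h2.symm
    · simp only [SimpleGraph.ConnectedComponent.map_mk, Option.some.injEq,
        SimpleGraph.ConnectedComponent.eq, SimpleGraph.Hom.coe_ofLE, id] at hCD h1 h2 ⊢
      rcases reachable_deleteEdges_or (x := x) (y := y) hCD with h | h | h
      · exact h
      · exact absurd h.1 h1
      · exact absurd h.2.symm h2
  have := Nat.card_le_card_of_injective f hf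
  rwa [Finite.card_option] at this

theorem card_connectedComponent_deleteEdges_le_of_reachable
    (h : (G.deleteEdges {s(x, y)}).Reachable x y) :
    Nat.card (G.deleteEdges {s(x, y)}).ConnectedComponent ≤ Nat.card G.ConnectedComponent := by
  refine Nat.card_le_card_of_injective (fun C ↦ C.map (SimpleGraph.Hom.ofLE
    (SimpleGraph.deleteEdges_le _))) fun C D hCD ↦ ?_
  induction C using SimpleGraph.ConnectedComponent.ind with | _ a
  induction D using SimpleGraph.ConnectedComponent.ind with | _ b
  simp only [SimpleGraph.ConnectedComponent.map_mk,
    SimpleGraph.ConnectedComponent.eq, SimpleGraph.Hom.coe_ofLE, id] at hCD ⊢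
  rcases reachable_deleteEdges_or (x := x) (y := y) hCD with h' | h' | h'
  · exact h'
  · exact h'.1.trans (h.trans h'.2)
  · exact h'.1.trans (h.symm.trans h'.2)

theorem cyclomaticNumber_deleteEdges_le (h : G.Adj x y) :
    cyclomaticNumber (G.deleteEdges {s(x, y)}) ≤ cyclomaticNumber G := by
  have h1 := card_edgeSet_deleteEdges h
  have h2 := card_connectedComponent_deleteEdges_le (G := G) (x := x) (y := y)
  unfold cyclomaticNumber
  omega

theorem cyclomaticNumber_deleteEdges_lt (h : G.Adj x y)
    (hr : (G.deleteEdges {s(x, y)}).Reachable x y) :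
    cyclomaticNumber (G.deleteEdges {s(x, y)}) < cyclomaticNumber G := by
  have h1 := card_edgeSet_deleteEdges h
  have h2 := card_connectedComponent_deleteEdges_le_of_reachable hr
  unfold cyclomaticNumber
  omega

end EdgeDeletion

/-! ### Cyclomatic number under vertex deletion -/

section VertexDeletion

variable {V : Type*} [Finite V] {G : SimpleGraph V} {v : V}

theorem card_subtype_ne (v : V) : Nat.card {x | x ≠ v} + 1 = Nat.card V := by
  have := Set.ncard_add_ncard_compl {v}
  rw [Set.ncard_singleton, add_comm] at this
  exact this

theorem card_edgeSet_induce_ne_add_le :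
    Nat.card (G.induce {x | x ≠ v}).edgeSet + Nat.card (G.neighborSet v) ≤
      Nat.card G.edgeSet := by
  rw [← Nat.card_sum]
  let f : (G.induce {x | x ≠ v}).edgeSet ⊕ G.neighborSet v → G.edgeSet := Sum.elim
    (fun e ↦ (SimpleGraph.Embedding.induce (G := G) {x | x ≠ v}).mapEdgeSet e)
    (fun w ↦ ⟨s(v, w), w.2⟩)
  refine Nat.card_le_card_of_injective f ?_
  refine Function.Injective.sumElim (SimpleGraph.Embedding.mapEdgeSet _).injective ?_ ?_
  · intro a b h
    exact Subtype.ext (Sym2.congr_right.1 (congrArg Subtype.val h))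
  · rintro ⟨e, he⟩ ⟨w, hw⟩ h
    induction e using Sym2.ind with | _ a b
    have h' := congrArg Subtype.val h
    have ha : a.1 ≠ v := a.2
    have hb : b.1 ≠ v := b.2
    change s(a.1, b.1) = s(v, w) at h'
    rcases Sym2.eq_iff.1 h' with h' | h'
    · exact ha h'.1
    · exact hb h'.2

/-- A component of G - v containing a neighbour of v is charged to one such neighbour. Any other is
already a component of G, different from that of v, which leaves the component of v free to account
for the extra 1. -/
theorem card_connectedComponent_induce_ne_le :
    Nat.card (G.induce {x | x ≠ v}).ConnectedComponent + 1 ≤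
      Nat.card G.ConnectedComponent + Nat.card (G.neighborSet v) := by
  classical
  set H := G.induce {x | x ≠ v} with hH
  let g : H →g G := (SimpleGraph.Embedding.induce (G := G) {x | x ≠ v}).toHom
  let P : H.ConnectedComponent → Prop := fun C ↦
    ∃ w : {x | x ≠ v}, G.Adj v w ∧ H.connectedComponentMk w = C
  let f : Option H.ConnectedComponent → G.ConnectedComponent ⊕ G.neighborSet v := fun o ↦
    match o with
    | none => Sum.inl (G.connectedComponentMk v)
    | some C => if h : P C then Sum.inr ⟨(Classical.choose h).1, (Classical.choose_spec h).1⟩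
        else Sum.inl (C.map g)
  -- A component of G - v without neighbours of v cannot be left in G.
  have key : ∀ (a : {x | x ≠ v}) (b : V), ¬ P (H.connectedComponentMk a) →
      G.Reachable a b → ∃ hb : b ≠ v, H.Reachable a ⟨b, hb⟩ := by
    intro a b ha hab
    refine reachable_induction (P := fun b ↦ ∃ hb : b ≠ v, H.Reachable a ⟨b, hb⟩)
      hab ⟨a.2, .rfl⟩ ?_
    rintro c d hcd ⟨hc, hac⟩
    have hd : d ≠ v := by
      rintro rfl
      exact ha ⟨⟨c, hc⟩, hcd.symm, by
        rw [SimpleGraph.ConnectedComponent.eq]; exact hac.symm⟩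
    refine ⟨hd, hac.trans (SimpleGraph.Adj.reachable ?_)⟩
    exact hcd
  have hf : Function.Injective f := by
    rintro (_ | C) (_ | D) h
    · rfl
    · exfalso
      induction D using SimpleGraph.ConnectedComponent.ind with | _ b
      simp only [f] at h
      split_ifs at h with h1
      simp only [SimpleGraph.ConnectedComponent.map_mk, Sum.inl.injEq,
        SimpleGraph.ConnectedComponent.eq] at h
      obtain ⟨hb, -⟩ := key b v h1 h.symm
      exact hb rfl
    · exfalso
      induction C using SimpleGraph.ConnectedComponent.ind with | _ b
      simp only [f] at h
      split_ifs at h with h1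
      simp only [SimpleGraph.ConnectedComponent.map_mk, Sum.inl.injEq,
        SimpleGraph.ConnectedComponent.eq] at h
      obtain ⟨hb, -⟩ := key b v h1 h
      exact hb rfl
    · congr 1
      simp only [f] at h
      split_ifs at h with h1 h2 h2
      · have h3 := congrArg Subtype.val (Sum.inr.inj h)
        have h4 : Classical.choose h1 = Classical.choose h2 := Subtype.ext h3
        exact (Classical.choose_spec h1).2.symm.trans
          ((congrArg _ h4).trans (Classical.choose_spec h2).2)
      · induction C using SimpleGraph.ConnectedComponent.ind with | _ a
        induction D using SimpleGraph.ConnectedComponent.ind with | _ b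
        simp only [SimpleGraph.ConnectedComponent.map_mk, Sum.inl.injEq,
          SimpleGraph.ConnectedComponent.eq] at h ⊢
        obtain ⟨hb, hr⟩ := key a b h1 h
        exact hr
  have := Nat.card_le_card_of_injective f hf
  rwa [Finite.card_option, Nat.card_sum] at this

theorem cyclomaticNumber_induce_ne_le :
    cyclomaticNumber (G.induce {x | x ≠ v}) ≤ cyclomaticNumber G := by
  have h1 := card_edgeSet_induce_ne_add_le (G := G) (v := v)
  have h2 := card_connectedComponent_induce_ne_le (G := G) (v := v)
  have h3 := card_subtype_ne v
  unfold cyclomaticNumber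
  omega

theorem cyclomaticNumber_induce_ne_lt (hv : 2 ≤ Nat.card (G.neighborSet v))
    (hG : (G.induce {x | x ≠ v}).Preconnected) :
    cyclomaticNumber (G.induce {x | x ≠ v}) < cyclomaticNumber G := by
  have h1 := card_edgeSet_induce_ne_add_le (G := G) (v := v)
  have h2 : Nat.card (G.induce {x | x ≠ v}).ConnectedComponent ≤ 1 :=
    have := hG.subsingleton_connectedComponent
    Finite.card_le_one_iff_subsingleton.2 this
  have h3 := card_subtype_ne v
  have h4 : 0 < Nat.card G.ConnectedComponent :=
    have : Nonempty G.ConnectedComponent := ⟨G.connectedComponentMk v⟩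
    Nat.card_pos
  unfold cyclomaticNumber
  omega

end VertexDeletion

/-! ### Cyclomatic number under contraction of two vertices -/

section Contraction

variable {V : Type} {G : SimpleGraph V} {u v : V}

open Classical in
/-- The projection of the vertices of `G` onto the vertices of `G / U`. -/
noncomputable def contractMap (U : Set V) (x : V) : Option {x : V // x ∉ U} :=
  if h : x ∈ U then none else some ⟨x, h⟩

theorem contractMap_of_mem {U : Set V} {x : V} (h : x ∈ U) : contractMap U x = none :=
  dif_pos h

theorem contractMap_of_notMem {U : Set V} {x : V} (h : x ∉ U) :
    contractMap U x = some ⟨x, h⟩ :=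
  dif_neg h

theorem contractMap_surjective {U : Set V} (hU : U.Nonempty) :
    Function.Surjective (contractMap U) := by
  rintro (_ | ⟨x, hx⟩)
  · obtain ⟨u, hu⟩ := hU
    exact ⟨u, contractMap_of_mem hu⟩
  · exact ⟨x, contractMap_of_notMem hx⟩

theorem reachable_contractMap (U : Set V) {x y : V} (h : G.Adj x y) :
    (contract G U).Reachable (contractMap U x) (contractMap U y) := by
  by_cases hx : x ∈ U <;> by_cases hy : y ∈ U
  · rw [contractMap_of_mem hx, contractMap_of_mem hy]
  · rw [contractMap_of_mem hx, contractMap_of_notMem hy]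
    exact SimpleGraph.Adj.reachable ⟨x, hx, h⟩
  · rw [contractMap_of_mem hy, contractMap_of_notMem hx]
    exact SimpleGraph.Adj.reachable ⟨y, hy, h.symm⟩
  · rw [contractMap_of_notMem hx, contractMap_of_notMem hy]
    exact SimpleGraph.Adj.reachable h

theorem card_connectedComponent_contract_le [Finite V] {U : Set V} (hU : U.Nonempty) :
    Nat.card (contract G U).ConnectedComponent ≤ Nat.card G.ConnectedComponent := by
  let f : G.ConnectedComponent → (contract G U).ConnectedComponent :=
    Quot.lift (fun x ↦ (contract G U).connectedComponentMk (contractMap U x)) (by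
      intro a b hab
      rw [SimpleGraph.ConnectedComponent.eq]
      exact reachable_induction (P := fun z ↦ (contract G U).Reachable (contractMap U a)
        (contractMap U z)) hab .rfl fun c d hcd h ↦ h.trans (reachable_contractMap U hcd))
  refine Nat.card_le_card_of_surjective f fun C ↦ ?_
  induction C using SimpleGraph.ConnectedComponent.ind with | _ z
  obtain ⟨x, rfl⟩ := contractMap_surjective hU z
  exact ⟨G.connectedComponentMk x, rfl⟩

theorem card_contract_pair [Finite V] (huv : u ≠ v) :
    Nat.card (Option {x : V // x ∉ ({u, v} : Set V)}) + 1 = Nat.card V := by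
  have h := Set.ncard_add_ncard_compl {u, v}
  rw [Set.ncard_pair huv] at h
  rw [Finite.card_option]
  change Nat.card {x : V // x ∉ ({u, v} : Set V)} + 1 + 1 = _
  have h' : Nat.card {x : V // x ∉ ({u, v} : Set V)} = ({u, v}ᶜ : Set V).ncard := rfl
  omega

/-- For each common neighbour w the edges uw and vw have the same image, so all edges vw of this
kind can be dropped and the rest still cover the edges of the contraction. -/
theorem card_edgeSet_contract_pair_add_le [Finite V] (huv : u ≠ v) :
    Nat.card (contract G {u, v}).edgeSet + Nat.card {w | G.Adj u w ∧ G.Adj v w} ≤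
      Nat.card G.edgeSet := by
  set U : Set V := {u, v} with hU
  let W : Set V := {w | G.Adj u w ∧ G.Adj v w}
  let R : Set (Sym2 V) := (fun w ↦ s(v, w)) '' W
  have hR : R ⊆ G.edgeSet := by
    rintro _ ⟨w, hw, rfl⟩
    exact hw.2
  have hRc : R.ncard = W.ncard := Set.ncard_image_of_injective _ fun a b h ↦ Sym2.congr_right.1 h
  have hv : ∀ a b, a ≠ v → b ≠ v → s(a, b) ∉ R := by
    rintro a b ha hb ⟨w, -, h⟩
    rcases Sym2.eq_iff.1 h with h | h
    · exact ha h.1.symm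
    · exact hb h.1.symm
  have hnone : ∀ y : {x : V // x ∉ U}, (∃ z ∈ U, G.Adj z y) →
      s(none, some y) ∈ Sym2.map (contractMap U) '' (G.edgeSet \ R) := by
    rintro ⟨y, hy⟩ ⟨z, hz, hzy⟩
    have hyv : y ≠ v := by rintro rfl; exact hy (by simp [hU])
    -- The preimage is taken at u whenever possible; an edge from v is used only if y is not a
    -- common neighbour, so it is not in `R`.
    by_cases huy : G.Adj u y
    · exact ⟨s(u, y), ⟨huy, hv _ _ huv hyv⟩, by
        rw [Sym2.map_mk, contractMap_of_mem (by simp [hU]), contractMap_of_notMem hy]⟩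
    · refine ⟨s(z, y), ⟨hzy, ?_⟩, by
        rw [Sym2.map_mk, contractMap_of_mem hz, contractMap_of_notMem hy]⟩
      rintro ⟨w, hw, h⟩
      rcases Sym2.eq_iff.1 h with h | h
      · exact huy (h.2 ▸ hw.1)
      · exact hyv h.1.symm
  have hsub : (contract G U).edgeSet ⊆ Sym2.map (contractMap U) '' (G.edgeSet \ R) := by
    intro e he
    induction e using Sym2.ind with | _ a b
    rcases a with _ | ⟨a, ha⟩ <;> rcases b with _ | ⟨b, hb⟩
    · exact absurd he id
    · exact hnone _ he
    · rw [Sym2.eq_swap]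
      exact hnone _ he
    · refine ⟨s(a, b), ⟨he, hv _ _ ?_ ?_⟩, by
        rw [Sym2.map_mk, contractMap_of_notMem ha, contractMap_of_notMem hb]⟩
      · rintro rfl; exact ha (by simp [hU])
      · rintro rfl; exact hb (by simp [hU])
  have h1 : (contract G U).edgeSet.ncard ≤ (G.edgeSet \ R).ncard :=
    (Set.ncard_le_ncard hsub).trans (Set.ncard_image_le (Set.toFinite _))
  have h2 := Set.ncard_sdiff_add_ncard_of_subset hR
  change (contract G U).edgeSet.ncard + W.ncard ≤ G.edgeSet.ncard
  omega

/-- One common neighbour gives monotonicity, two give a strict decrease. -/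
theorem cyclomaticNumber_contract_pair_add_le [Finite V] (huv : u ≠ v) :
    cyclomaticNumber (contract G {u, v}) + Nat.card {w | G.Adj u w ∧ G.Adj v w} ≤
      cyclomaticNumber G + 1 := by
  have h1 := card_edgeSet_contract_pair_add_le (G := G) huv
  have h2 := card_connectedComponent_contract_le (G := G) (U := {u, v}) ⟨u, by simp⟩
  have h3 := card_contract_pair huv
  unfold cyclomaticNumber
  omega

end Contraction

theorem IsAdmissible.exists_adj {V : Type} {G : SimpleGraph V} {u v : V}
    (h : IsAdmissible G u v) : ∃ w, G.Adj u w ∧ G.Adj v w := by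
  obtain ⟨-, w, a, c, -, -, h1, h2⟩ := h
  exact ⟨w, c.adj_of_mem_edges h1, (c.adj_of_mem_edges h2).symm⟩

theorem IsStep.cyclomaticNumber_le {H G : FinGraph} (h : IsStep H G) :
    cyclomaticNumber H.graph ≤ cyclomaticNumber G.graph := by
  have := G.finite
  rcases h with ⟨v, ⟨φ⟩⟩ | ⟨e, he, ⟨φ⟩⟩ | ⟨u, v, huv, ⟨φ⟩⟩
  · rw [cyclomaticNumber_congr φ]
    exact cyclomaticNumber_induce_ne_le
  · rw [cyclomaticNumber_congr φ]
    induction e using Sym2.ind with | _ x y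
    exact cyclomaticNumber_deleteEdges_le he
  · rw [cyclomaticNumber_congr φ]
    obtain ⟨w, hw⟩ := huv.exists_adj
    have h1 := cyclomaticNumber_contract_pair_add_le (G := G.graph) huv.1
    have h2 : 0 < Nat.card {w | G.graph.Adj u w ∧ G.graph.Adj v w} :=
      have : Nonempty {w | G.graph.Adj u w ∧ G.graph.Adj v w} := ⟨⟨w, hw⟩⟩
      Nat.card_pos
    omega

end BipMinor
-- D(k,4,4) as a Hamiltonian cycle with two chords
namespace BipMinor

/-- The edges of the graph `twoEaredCycle n`, each listed in one direction. -/
def TwoEaredRel (n i j : ℕ) : Prop :=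
  i + 1 = j ∨ (i = 0 ∧ j + 1 = n) ∨ (i = 0 ∧ j = 3) ∨ (i = 4 ∧ j = 7)

/-- The Hamiltonian cycle `0, …, n - 1` with the two chords from `0` to `3` and from `4` to `7`. -/
def twoEaredCycle (n : ℕ) : SimpleGraph (Fin n) :=
  SimpleGraph.fromRel fun i j ↦ TwoEaredRel n i j

theorem twoEaredCycle_adj {n : ℕ} (hn : 8 ≤ n) {i j : Fin n} :
    (twoEaredCycle n).Adj i j ↔ TwoEaredRel n i j ∨ TwoEaredRel n j i := by
  rw [twoEaredCycle, SimpleGraph.fromRel_adj, and_iff_right_iff_imp, Ne, Fin.ext_iff]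
  unfold TwoEaredRel
  omega

section Dog

theorem cycleGraph_adj_iff_val {k : ℕ} (hk : 2 ≤ k) {a b : Fin k} :
    (SimpleGraph.cycleGraph k).Adj a b ↔ a.val + 1 = b.val ∨ b.val + 1 = a.val ∨
      (a.val = 0 ∧ b.val + 1 = k) ∨ (b.val = 0 ∧ a.val + 1 = k) := by
  rw [SimpleGraph.cycleGraph_adj']
  rcases lt_trichotomy a b with h | h | h
  · rw [Fin.coe_sub_iff_lt.2 h, Fin.coe_sub_iff_le.2 h.le]
    rw [Fin.lt_def] at h
    omega
  · subst h
    rw [Fin.coe_sub_iff_le.2 le_rfl]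
    omega
  · rw [Fin.coe_sub_iff_lt.2 h, Fin.coe_sub_iff_le.2 h.le]
    rw [Fin.lt_def] at h
    omega

theorem val_lt_two {i : Fin 2} (j : Fin ((![4, 4] : Fin 2 → ℕ) i - 2)) : j.val < 2 := by
  have := j.2
  fin_cases i <;> exact this

/-- The position of a vertex of `D(k, 4, 4)` on the Hamiltonian cycle. -/
def dogIndex {k : ℕ} (hk : 4 ≤ k) :
    Fin k ⊕ (Σ i : Fin 2, Fin ((![4, 4] : Fin 2 → ℕ) i - 2)) → Fin (k + 4)
  -- The snout vertices 0, 1, 2, 3 go to 0, 3, 4, 7, making room for the inner ear vertices at 1, 2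
  -- and 5, 6; later snout vertices are shifted by four.
  | .inl a => ⟨if a.val < 2 then 3 * a.val else if a.val < 4 then 3 * a.val - 2 else a.val + 4, by
      have := a.2
      split_ifs <;> omega⟩
  | .inr x => ⟨4 * x.1.val + 1 + x.2.val, by
      have := x.1.2
      have := val_lt_two x.2
      omega⟩

theorem dogIndex_injective {k : ℕ} (hk : 4 ≤ k) : Function.Injective (dogIndex hk) := by
  rintro (a | ⟨i, a⟩) (b | ⟨j, b⟩) h
  · have h := congrArg Fin.val h
    simp only [dogIndex] at h
    congr 1
    ext
    split_ifs at h <;> omega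
  · have h := congrArg Fin.val h
    have := val_lt_two b
    have : j.val = 0 ∨ j.val = 1 := by omega
    simp only [dogIndex] at h
    split_ifs at h <;> omega
  · have h := congrArg Fin.val h
    have := val_lt_two a
    have : i.val = 0 ∨ i.val = 1 := by omega
    simp only [dogIndex] at h
    split_ifs at h <;> omega
  · have h := congrArg Fin.val h
    have := val_lt_two a
    have := val_lt_two b
    simp only [dogIndex] at h
    obtain rfl : i = j := by ext; omega
    obtain rfl : a = b := by ext; omega
    rfl

theorem dogIndex_bijective {k : ℕ} (hk : 4 ≤ k) : Function.Bijective (dogIndex hk) := by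
  rw [Fintype.bijective_iff_injective_and_card]
  refine ⟨dogIndex_injective hk, ?_⟩
  simp [Fintype.card_sum, Fintype.card_sigma, Fin.sum_univ_two]

theorem twoEaredRel_dogIndex {k : ℕ} (hk : 4 ≤ k)
    (x y : Fin k ⊕ (Σ i : Fin 2, Fin ((![4, 4] : Fin 2 → ℕ) i - 2))) :
    (TwoEaredRel (k + 4) (dogIndex hk x) (dogIndex hk y) ∨
      TwoEaredRel (k + 4) (dogIndex hk y) (dogIndex hk x)) ↔
    (dogRel k ![4, 4] x y ∨ dogRel k ![4, 4] y x) := by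
  have ear (i : Fin 2) : (![4, 4] : Fin 2 → ℕ) i = 4 := by fin_cases i <;> rfl
  have inlinr (a : Fin k) (x : Σ i : Fin 2, Fin ((![4, 4] : Fin 2 → ℕ) i - 2)) :
      (TwoEaredRel (k + 4) (dogIndex hk (.inl a)) (dogIndex hk (.inr x)) ∨
        TwoEaredRel (k + 4) (dogIndex hk (.inr x)) (dogIndex hk (.inl a))) ↔
      dogRel k ![4, 4] (.inl a) (.inr x) := by
    have := val_lt_two x.2
    have := x.1.2
    have := a.2
    simp only [dogRel, dogIndex, TwoEaredRel, ear]
    split_ifs <;> omega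
  rcases x with a | x <;> rcases y with b | y
  · have := a.2
    have := b.2
    simp only [dogRel, dogIndex, TwoEaredRel, cycleGraph_adj_iff_val (show 2 ≤ k by omega)]
    split_ifs <;> (try simp only [false_and, false_or]) <;> omega
  · rw [inlinr]
    simp [dogRel]
  · rw [or_comm, inlinr]
    simp [dogRel]
  · have := val_lt_two x.2
    have := x.1.2
    have := val_lt_two y.2
    have := y.1.2
    simp only [dogRel, dogIndex, TwoEaredRel, Fin.ext_iff]
    omega

/-- The dog `D(k, 4, 4)` is a Hamiltonian cycle with two chords. -/
noncomputable def dogIso {k : ℕ} (hk : 4 ≤ k) :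
    (dog k ![4, 4]).graph ≃g twoEaredCycle (k + 4) where
  toEquiv := Equiv.ofBijective (dogIndex hk) (dogIndex_bijective hk)
  map_rel_iff' := by
    intro x y
    refine (twoEaredCycle_adj (by omega)).trans ((twoEaredRel_dogIndex hk x y).trans ?_)
    refine Iff.trans ?_ (SimpleGraph.fromRel_adj _ _ _).symm
    refine iff_and_self.2 fun h ↦ ?_
    rintro rfl
    have h' := (twoEaredRel_dogIndex hk x x).2 h
    unfold TwoEaredRel at h'
    omega

end Dog

/-! ### Bipartiteness, edge count, 2-connectedness and minimum degree -/

section Structure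

variable {n : ℕ}

theorem twoEaredCycle_isBipartite (hn : 8 ≤ n) (he : Even n) :
    (twoEaredCycle n).IsBipartite := by
  refine ⟨SimpleGraph.Coloring.mk (fun i ↦ ⟨i.val % 2, by omega⟩) fun {i j} h ↦ ?_⟩
  rw [twoEaredCycle_adj hn] at h
  obtain ⟨m, rfl⟩ := he
  unfold TwoEaredRel at h
  rw [Ne, Fin.ext_iff]
  dsimp only
  omega

/-- The endpoints of the edge number `i` of `twoEaredCycle n`. -/
def twoEaredEdge (hn : 8 ≤ n) (i : Fin (n + 2)) : Sym2 (Fin n) :=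
  s(⟨if i.val + 1 < n then i else if i.val = n + 1 then 4 else 0, by split_ifs <;> omega⟩,
    ⟨if i.val + 1 < n then i.val + 1 else if i.val + 1 = n then i else
      if i.val = n then 3 else 7, by split_ifs <;> omega⟩)

theorem twoEaredEdge_injective (hn : 8 ≤ n) : Function.Injective (twoEaredEdge hn) := by
  intro i j h
  have h1 := i.2
  have h2 := j.2
  ext
  simp only [twoEaredEdge, Sym2.eq_iff, Fin.mk.injEq] at h
  split_ifs at h <;> (try simp only [false_and, and_false, or_false, or_self] at h) <;> omega

theorem range_twoEaredEdge (hn : 8 ≤ n) :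
    Set.range (twoEaredEdge hn) = (twoEaredCycle n).edgeSet := by
  have key (a b : Fin n) (h : TwoEaredRel n a b) : s(a, b) ∈ Set.range (twoEaredEdge hn) := by
    have ha := a.2
    have hb := b.2
    simp only [Set.mem_range, twoEaredEdge, Sym2.eq_iff, Fin.ext_iff]
    rcases h with h | h | h | h
    · exact ⟨⟨a, by omega⟩, Or.inl (by dsimp only; split_ifs <;> omega)⟩
    · exact ⟨⟨n - 1, by omega⟩, Or.inl (by dsimp only; split_ifs <;> omega)⟩
    · exact ⟨⟨n, by omega⟩, Or.inl (by dsimp only; split_ifs <;> omega)⟩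
    · exact ⟨⟨n + 1, by omega⟩, Or.inl (by dsimp only; split_ifs <;> omega)⟩
  ext e
  constructor
  · rintro ⟨i, rfl⟩
    have := i.2
    rw [twoEaredEdge, SimpleGraph.mem_edgeSet, twoEaredCycle_adj hn]
    simp only [TwoEaredRel]
    split_ifs <;> omega
  · induction e using Sym2.ind with | _ a b
    intro h
    rw [SimpleGraph.mem_edgeSet, twoEaredCycle_adj hn] at h
    rcases h with h | h
    · exact key a b h
    · rw [Sym2.eq_swap]
      exact key b a h

theorem card_edgeSet_twoEaredCycle (hn : 8 ≤ n) :
    Nat.card (twoEaredCycle n).edgeSet = n + 2 := by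
  rw [← range_twoEaredEdge hn, Nat.card_range_of_injective (twoEaredEdge_injective hn),
    Nat.card_fin]

variable {V : Type} {G : SimpleGraph V}

/-- The Hamiltonian cycle suffices: removing one vertex leaves a Hamiltonian path of the rest. -/
theorem isKConnected_two_of_iso (hn : 8 ≤ n) (φ : G ≃g twoEaredCycle n) :
    IsKConnected 2 G := by
  classical
  let f : ℕ → V := fun i ↦ φ.symm ⟨i % n, Nat.mod_lt _ (by omega)⟩
  have hadj (i : ℕ) : G.Adj (f i) (f (i + 1)) := by
    refine φ.symm.map_adj_iff.2 ((twoEaredCycle_adj hn).2 ?_)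
    have h1 := Nat.mod_lt i (show 0 < n by omega)
    simp only [TwoEaredRel]
    by_cases h : i % n + 1 < n
    · have : (i + 1) % n = i % n + 1 := by
        rw [Nat.add_mod, Nat.mod_eq_of_lt (show 1 < n by omega), Nat.mod_eq_of_lt h]
      omega
    · have : (i + 1) % n = 0 := by
        rw [Nat.add_mod, Nat.mod_eq_of_lt (show 1 < n by omega),
          show i % n + 1 = n by omega, Nat.mod_self]
      omega
  have hsurj (v : V) : ∃ i < n, f i = v := by
    refine ⟨φ v, (φ v).2, ?_⟩
    simp only [f, Nat.mod_eq_of_lt (φ v).2]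
    exact φ.symm_apply_apply v
  have hper (i : ℕ) : f (i + n) = f i := by simp [f]
  have hinj (i j : ℕ) (h : f i = f j) : i % n = j % n :=
    congrArg Fin.val (φ.symm.injective h)
  intro U hU
  have path (s m : ℕ) (hm : ∀ j ≤ m, f (s + j) ∉ U) (j : ℕ) (hj : j ≤ m) :
      (G.induce {x | x ∉ U}).Reachable ⟨f s, hm 0 m.zero_le⟩ ⟨f (s + j), hm j hj⟩ := by
    induction j with
    | zero => exact .rfl
    | succ j ih => exact (ih (by omega)).trans (SimpleGraph.Adj.reachable (hadj (s + j)))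
  rcases U.eq_empty_or_nonempty with rfl | ⟨x, hx⟩
  · have hr (v : {x | x ∉ (∅ : Finset V)}) : (G.induce {x | x ∉ (∅ : Finset V)}).Reachable
        ⟨f 0, by simp⟩ v := by
      obtain ⟨v, hv⟩ := v
      obtain ⟨i, -, rfl⟩ := hsurj v
      have := path 0 i (by simp) i le_rfl
      simpa only [Nat.zero_add] using this
    exact fun a b ↦ (hr a).symm.trans (hr b)
  · obtain ⟨s, hs, rfl⟩ := hsurj x
    have hUs (v : V) : v ∈ U ↔ v = f s := by
      refine ⟨fun hv ↦ Finset.card_le_one.1 (by omega) v hv _ hx, fun h ↦ h ▸ hx⟩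
    -- The indices s + 1, …, s + n - 1 run once around the cycle through everything except f s.
    have hm (j : ℕ) (hj : j ≤ n - 2) : f (s + 1 + j) ∉ U := by
      rw [hUs]
      intro h
      have h' := hinj _ _ h
      rw [Nat.mod_eq_of_lt hs] at h'
      rcases lt_or_ge (s + 1 + j) n with h1 | h1
      · rw [Nat.mod_eq_of_lt h1] at h'
        omega
      · rw [Nat.mod_eq_sub_mod h1, Nat.mod_eq_of_lt (by omega)] at h'
        omega
    have hr (v : {x | x ∉ U}) : (G.induce {x | x ∉ U}).Reachable
        ⟨f (s + 1), hm 0 (by omega)⟩ v := by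
      obtain ⟨v, hv⟩ := v
      obtain ⟨i, hi, rfl⟩ := hsurj v
      have his : i ≠ s := by
        rintro rfl
        exact hv hx
      rcases lt_or_gt_of_ne his with h | h
      · have := path (s + 1) (n - 2) hm (i + n - (s + 1)) (by omega)
        simpa only [show s + 1 + (i + n - (s + 1)) = i + n by omega, hper] using this
      · have := path (s + 1) (n - 2) hm (i - (s + 1)) (by omega)
        simpa only [show s + 1 + (i - (s + 1)) = i by omega] using this
    exact fun a b ↦ (hr a).symm.trans (hr b)

theorem IsKConnected.preconnected {k : ℕ} (hk : 0 < k) (h : IsKConnected k G) :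
    G.Preconnected := by
  intro a b
  have := h ∅ hk ⟨a, by simp⟩ ⟨b, by simp⟩
  exact this.map (SimpleGraph.Embedding.induce _).toHom

theorem IsKConnected.preconnected_induce_ne (h : IsKConnected 2 G) (v : V) :
    (G.induce {x | x ≠ v}).Preconnected := by
  have hv : {x | x ∉ ({v} : Finset V)} = {x | x ≠ v} := by
    ext x
    simp
  exact hv ▸ h {v} (by simp)

theorem IsKConnected.card_connectedComponent [Nonempty V] {k : ℕ} (hk : 0 < k)
    (h : IsKConnected k G) : Nat.card G.ConnectedComponent = 1 := by
  have := (h.preconnected hk).subsingleton_connectedComponent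
  have : Nonempty G.ConnectedComponent := ⟨G.connectedComponentMk (Classical.arbitrary V)⟩
  exact Nat.card_unique

theorem cyclomaticNumber_of_iso (hn : 8 ≤ n) (φ : G ≃g twoEaredCycle n) :
    cyclomaticNumber G = 3 := by
  have : Nonempty V := ⟨φ.symm ⟨0, by omega⟩⟩
  have h1 := (isKConnected_two_of_iso hn φ).card_connectedComponent (by omega)
  rw [cyclomaticNumber, h1, Nat.card_congr φ.toEquiv, Nat.card_congr φ.mapEdgeSet,
    card_edgeSet_twoEaredCycle hn, Nat.card_fin]
  push_cast
  ring

theorem exists_two_adj (hn : 8 ≤ n) (φ : G ≃g twoEaredCycle n) (v : V) :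
    ∃ a b, a ≠ b ∧ G.Adj v a ∧ G.Adj v b := by
  have key (i p q : ℕ) (hi : i < n) (hp : p < n) (hq : q < n) (hpq : p ≠ q)
      (h1 : TwoEaredRel n i p ∨ TwoEaredRel n p i) (h2 : TwoEaredRel n i q ∨ TwoEaredRel n q i)
      (hv : φ v = ⟨i, hi⟩) : ∃ a b, a ≠ b ∧ G.Adj v a ∧ G.Adj v b := by
    refine ⟨φ.symm ⟨p, hp⟩, φ.symm ⟨q, hq⟩, ?_, ?_, ?_⟩
    · rw [φ.symm.injective.ne_iff, Ne, Fin.mk.injEq]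
      exact hpq
    · rw [← φ.map_adj_iff, hv, φ.apply_symm_apply]
      exact (twoEaredCycle_adj hn).2 h1
    · rw [← φ.map_adj_iff, hv, φ.apply_symm_apply]
      exact (twoEaredCycle_adj hn).2 h2
  unfold TwoEaredRel at key
  by_cases h0 : (φ v).val = 0
  · exact key _ 1 (n - 1) (φ v).2 (by omega) (by omega) (by omega) (by omega) (by omega) rfl
  by_cases h1 : (φ v).val + 1 = n
  · exact key _ 0 (n - 2) (φ v).2 (by omega) (by omega) (by omega) (by omega) (by omega) rfl
  · exact key _ ((φ v).val - 1) ((φ v).val + 1) (φ v).2 (by omega) (by omega) (by omega)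
      (by omega) (by omega) rfl

end Structure

end BipMinor
namespace BipMinor

/-! ### Induced non-separating cycles are the ears -/

section InducedCycle

/-- Let `S` be the vertex set of an induced cycle of `twoEaredCycle n` that does not leave the
ears apart. Then two neighbours in `S` of a vertex `w` in `S` have another common neighbour. -/
theorem exists_common_neighbour {n : ℕ} (hn : 8 ≤ n) {A : ℕ → ℕ → Prop}
    (hA : ∀ i j, A i j ↔ TwoEaredRel n i j ∨ TwoEaredRel n j i) {S : ℕ → Prop}
    (hlt : ∀ i, S i → i < n)
    (hS : ∀ i, S i → ∃ p q, p ≠ q ∧ S p ∧ S q ∧ ∀ r, S r → A i r → r = p ∨ r = q)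
    (hSA : ∀ i a b, S i → (∀ j, S j → A i j → j = a ∨ j = b) → S a ∧ S b)
    (hsep : S 0 → S 3 → ¬ S 1 → ¬ S 2 → ¬ S 5 → False)
    {u v w : ℕ} (hu : S u) (hv : S v) (hw : S w) (hwu : A w u) (hwv : A w v) (huv : u ≠ v) :
    ∃ w' < n, w' ≠ w ∧ A u w' ∧ A v w' := by
  have three (i a b c : ℕ) (hi : S i) (ha : A i a) (hb : A i b) (hc : A i c) (hab : a ≠ b)
      (hac : a ≠ c) (hbc : b ≠ c) (h1 : S a) (h2 : S b) : ¬ S c := by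
    intro h3
    obtain ⟨p, q, -, -, -, h⟩ := hS i hi
    have := h a h1 ha
    have := h b h2 hb
    have := h c h3 hc
    omega
  have pair (a b : ℕ) (hab : a ≠ b) (ha : A w a) (hb : A w b) (h1 : S a) (h2 : S b) :
      (u = a ∧ v = b) ∨ (u = b ∧ v = a) := by
    obtain ⟨p, q, -, -, -, h⟩ := hS w hw
    have := h a h1 ha
    have := h b h2 hb
    have := h u hu hwu
    have := h v hv hwv
    omega
  -- The hypotheses `hS` and `hSA` encode that every vertex of S has exactly two neighbours in S: a
  -- third is excluded, and when only two candidates remain both are forced. Below, S is traced from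
  -- this.
  simp only [hA, TwoEaredRel] at *
  have h1 : S 1 → S 0 ∧ S 2 := fun h ↦ hSA 1 0 2 h fun j _ hj ↦ by omega
  have h2 : S 2 → S 1 ∧ S 3 := fun h ↦ hSA 2 1 3 h fun j _ hj ↦ by omega
  have h5 : S 5 → S 4 ∧ S 6 := fun h ↦ hSA 5 4 6 h fun j _ hj ↦ by omega
  have h6 : S 6 → S 5 ∧ S 7 := fun h ↦ hSA 6 5 7 h fun j _ hj ↦ by omega
  have descend : ∀ i, 8 ≤ i → S i → S (i - 1) := by
    intro i hi h
    have := hlt i h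
    by_cases hin : i + 1 = n
    · exact (hSA i (i - 1) 0 h fun j hj _ ↦ by have := hlt j hj; omega).1
    · exact (hSA i (i - 1) (i + 1) h fun j _ hj ↦ by omega).1
  -- The vertices from 8 on have degree two, so S follows the snout back to 7.
  have descend' : ∀ i, 8 ≤ i → S i → S 8 ∧ S 7 := by
    intro i hi
    induction i, hi using Nat.le_induction with
    | base => exact fun h ↦ ⟨h, descend 8 le_rfl h⟩
    | succ i hi ih => exact fun h ↦ ih (descend (i + 1) (by omega) h)
  -- S contains the ear 0, 1, 2, 3, and opposite vertices there share both remaining vertices.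
  by_cases s1 : S 1
  · obtain ⟨s0, s2⟩ := h1 s1
    have s3 := (h2 s2).2
    by_cases hw3 : w ≤ 3
    · interval_cases w
      · have := pair 1 3 (by omega) (by omega) (by omega) s1 s3
        exact ⟨2, by omega⟩
      · have := pair 0 2 (by omega) (by omega) (by omega) s0 s2
        exact ⟨3, by omega⟩
      · have := pair 1 3 (by omega) (by omega) (by omega) s1 s3
        exact ⟨0, by omega⟩
      · have := pair 0 2 (by omega) (by omega) (by omega) s0 s2
        exact ⟨1, by omega⟩
    -- The attachments 0 and 3 already have their two neighbours, so S cannot extend beyond the ear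
    -- and w cannot lie outside it.
    · exfalso
      have s4 : ¬ S 4 := three 3 0 2 4 s3 (by omega) (by omega) (by omega) (by omega) (by omega)
        (by omega) s0 s2
      have slast : ¬ S (n - 1) := three 0 1 3 (n - 1) s0 (by omega) (by omega) (by omega)
        (by omega) (by omega) (by omega) s1 s3
      have s5 : ¬ S 5 := fun h ↦ s4 (h5 h).1
      have s6 : ¬ S 6 := fun h ↦ s5 (h6 h).1
      have s7 : ¬ S 7 := fun h ↦ by
        refine s4 (hSA 7 4 8 h fun j hj hA ↦ ?_).1
        have : j ≠ 6 := by rintro rfl; exact s6 hj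
        have : n ≠ 8 := by rintro rfl; exact slast h
        omega
      have hw8 : ¬ 8 ≤ w := fun h ↦ s7 (descend' w h hw).2
      obtain rfl | rfl | rfl | rfl : w = 4 ∨ w = 5 ∨ w = 6 ∨ w = 7 := by omega
      exacts [s4 hw, s5 hw, s6 hw, s7 hw]
  have s2 : ¬ S 2 := fun h ↦ s1 (h2 h).1
  -- The same argument for the ear 4, 5, 6, 7.
  by_cases s5 : S 5
  · obtain ⟨s4, s6⟩ := h5 s5
    have s7 := (h6 s6).2
    by_cases hw4 : 4 ≤ w ∧ w ≤ 7
    · obtain ⟨hw4, hw7⟩ := hw4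
      interval_cases w
      · have := pair 5 7 (by omega) (by omega) (by omega) s5 s7
        exact ⟨6, by omega⟩
      · have := pair 4 6 (by omega) (by omega) (by omega) s4 s6
        exact ⟨7, by omega⟩
      · have := pair 5 7 (by omega) (by omega) (by omega) s5 s7
        exact ⟨4, by omega⟩
      · have := pair 4 6 (by omega) (by omega) (by omega) s4 s6
        exact ⟨5, by omega⟩
    · exfalso
      have s3 : ¬ S 3 := three 4 5 7 3 s4 (by omega) (by omega) (by omega) (by omega) (by omega)
        (by omega) s5 s7
      have s0 : ¬ S 0 := fun h ↦ s3 (hSA 0 3 (n - 1) h fun j hj hA ↦ by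
        have : j ≠ 1 := by rintro rfl; exact s1 hj
        omega).1
      have s8 : ¬ S 8 := fun h ↦ by
        have := hlt 8 h
        exact three 7 4 6 8 s7 (by omega) (by omega) (by omega) (by omega) (by omega)
          (by omega) s4 s6 h
      have hw8 : ¬ 8 ≤ w := fun h ↦ s8 (descend' w h hw).1
      obtain rfl | rfl | rfl | rfl : w = 0 ∨ w = 1 ∨ w = 2 ∨ w = 3 := by omega
      exacts [s0 hw, s1 hw, s2 hw, s3 hw]
  -- S avoids the inner vertices of both ears, so it follows the snout and contains the chord ends 0
  -- and 3, which `hsep` forbids.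
  · exfalso
    have s6 : ¬ S 6 := fun h ↦ s5 (h6 h).1
    have s3 : S 3 → S 0 ∧ S 4 := fun h ↦ hSA 3 0 4 h fun j hj hA ↦ by
      have : j ≠ 2 := by rintro rfl; exact s2 hj
      omega
    have s4 : S 4 → S 3 ∧ S 7 := fun h ↦ hSA 4 3 7 h fun j hj hA ↦ by
      have : j ≠ 5 := by rintro rfl; exact s5 hj
      omega
    have s0 : S 0 → S 3 ∧ S (n - 1) := fun h ↦ hSA 0 3 (n - 1) h fun j hj hA ↦ by
      have : j ≠ 1 := by rintro rfl; exact s1 hj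
      omega
    have s7 : S 7 → S 4 := fun h ↦ by
      -- The snout successor of 7 wraps around to 0 when the snout has length four.
      refine (hSA 7 4 (if n = 8 then 0 else 8) h fun j hj hA ↦ ?_).1
      have : j ≠ 6 := by rintro rfl; exact s6 hj
      have := hlt j hj
      split_ifs <;> omega
    have s7' : S 7 := by
      by_cases hw8 : 8 ≤ w
      · exact (descend' w hw8 hw).2
      obtain rfl | rfl | rfl | rfl | rfl | rfl | rfl | rfl : w = 0 ∨ w = 1 ∨ w = 2 ∨ w = 3 ∨
        w = 4 ∨ w = 5 ∨ w = 6 ∨ w = 7 := by omega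
      exacts [(s4 (s3 (s0 hw).1).2).2, absurd hw s1, absurd hw s2, (s4 (s3 hw).2).2, (s4 hw).2,
        absurd hw s5, absurd hw s6, hw]
    have s3' := (s4 (s7 s7')).1
    exact hsep (s3 s3').1 s3' s1 s2 s5

variable {n : ℕ} {V : Type} {G : SimpleGraph V}

/-- Without chords, adjacency in G between cycle vertices is adjacency along the cycle. -/
theorem IsInducedCycle.ncard_adj_mem_support {a : V} {c : G.Walk a a} (hc : IsInducedCycle G c)
    {x : V} (hx : x ∈ c.support) : {y | y ∈ c.support ∧ G.Adj x y}.ncard = 2 := by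
  rw [← hc.1.ncard_neighborSet_toSubgraph_eq_two hx]
  congr 1
  ext y
  rw [SimpleGraph.Subgraph.mem_neighborSet, SimpleGraph.Walk.adj_toSubgraph_iff_mem_edges]
  exact ⟨fun h ↦ hc.2 x hx y h.1 h.2, fun h ↦
    ⟨c.snd_mem_support_of_mem_edges h, c.adj_of_mem_edges h⟩⟩

theorem two_le_card_of_isAdmissible [Finite V] (hn : 8 ≤ n) (φ : G ≃g twoEaredCycle n) {u v : V}
    (h : IsAdmissible G u v) : 2 ≤ Nat.card {w | G.Adj u w ∧ G.Adj v w} := by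
  obtain ⟨huv, w, a, c, hc, hsep, huw, hwv⟩ := h
  let S : ℕ → Prop := fun i ↦ ∃ x ∈ c.support, (φ x).val = i
  let A : ℕ → ℕ → Prop := fun i j ↦ TwoEaredRel n i j ∨ TwoEaredRel n j i
  have hA (x y : V) : G.Adj x y ↔ A (φ x) (φ y) := by
    rw [← φ.map_adj_iff, twoEaredCycle_adj hn]
  have hval {x y : V} (hxy : (φ x).val = (φ y).val) : x = y := φ.injective (Fin.ext hxy)
  have hSpq (i : ℕ) (hi : S i) : ∃ p q, p ≠ q ∧ S p ∧ S q ∧ A i p ∧ A i q ∧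
      ∀ r, S r → A i r → r = p ∨ r = q := by
    obtain ⟨x, hx, rfl⟩ := hi
    obtain ⟨p, q, hpq, hS⟩ := Set.ncard_eq_two.1 (hc.ncard_adj_mem_support hx)
    have hp : p ∈ {y | y ∈ c.support ∧ G.Adj x y} := by simp [hS]
    have hq : q ∈ {y | y ∈ c.support ∧ G.Adj x y} := by simp [hS]
    refine ⟨φ p, φ q, fun h ↦ hpq (hval h), ⟨p, hp.1, rfl⟩, ⟨q, hq.1, rfl⟩, (hA _ _).1 hp.2,
      (hA _ _).1 hq.2, ?_⟩
    rintro _ ⟨r, hr, rfl⟩ hxr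
    have : r ∈ {y | y ∈ c.support ∧ G.Adj x y} := ⟨hr, (hA _ _).2 hxr⟩
    rw [hS] at this
    rcases this with rfl | rfl
    exacts [Or.inl rfl, Or.inr rfl]
  have hnot (i : ℕ) (hi : i < n) (h : ¬ S i) : φ.symm ⟨i, hi⟩ ∉ c.support :=
    fun h' ↦ h ⟨_, h', by rw [φ.apply_symm_apply]⟩
  obtain ⟨w', hw', hne, h1, h2⟩ := exists_common_neighbour hn (A := A) (fun _ _ ↦ Iff.rfl)
    (S := S) (by rintro _ ⟨x, -, rfl⟩; exact (φ x).2)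
    (fun i hi ↦ by
      obtain ⟨p, q, h1, h2, h3, -, -, h4⟩ := hSpq i hi
      exact ⟨p, q, h1, h2, h3, h4⟩)
    (fun i a b hi hab ↦ by
      obtain ⟨p, q, h1, h2, h3, h4, h5, -⟩ := hSpq i hi
      have hp := hab p h2 h4
      have hq := hab q h3 h5
      rcases hp with rfl | rfl <;> rcases hq with rfl | rfl
      exacts [absurd rfl h1, ⟨h2, h3⟩, ⟨h3, h2⟩, absurd rfl h1])
    (fun s0 s3 s1 s2 s5 ↦ by
      have hK := isKConnected_two_of_iso hn φ
      have h1 : ENat.card (G.induce {x | x ∉ c.support}).ConnectedComponent ≤ 1 := by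
        refine hsep.trans ?_
        have := (hK.preconnected (by omega)).subsingleton_connectedComponent
        exact ENat.card_le_one_iff_subsingleton _ |>.2 this
      have h2 := (ENat.card_le_one_iff_subsingleton _).1 h1
      have hr : (G.induce {x | x ∉ c.support}).Reachable
          ⟨φ.symm ⟨1, by omega⟩, hnot 1 (by omega) s1⟩
          ⟨φ.symm ⟨5, by omega⟩, hnot 5 (by omega) s5⟩ :=
        SimpleGraph.ConnectedComponent.exact (Subsingleton.elim _ _)
      -- With 0 and 3 deleted nothing leaves {1, 2}, so 1 and 5 are separated, although a
      -- non-separating cycle must leave a connected graph.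
      have := reachable_induction (P := fun x ↦ (φ x.1).val = 1 ∨ (φ x.1).val = 2) hr
        (by simp) (by
          rintro ⟨x, hx⟩ ⟨y, hy⟩ hxy hx'
          have hxy := (hA x y).1 hxy
          have hy0 : (φ y).val ≠ 0 := fun h ↦ by
            obtain ⟨z, hz, hz'⟩ := s0
            exact hy (hval (h.trans hz'.symm) ▸ hz)
          have hy3 : (φ y).val ≠ 3 := fun h ↦ by
            obtain ⟨z, hz, hz'⟩ := s3
            exact hy (hval (h.trans hz'.symm) ▸ hz)
          simp only [A, TwoEaredRel] at hxy
          dsimp only at hx' ⊢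
          omega)
      simp at this)
    (u := φ u) (v := φ v) (w := φ w)
    ⟨u, c.fst_mem_support_of_mem_edges huw, rfl⟩ ⟨v, c.snd_mem_support_of_mem_edges hwv, rfl⟩
    ⟨w, c.snd_mem_support_of_mem_edges huw, rfl⟩ ((hA _ _).1 (c.adj_of_mem_edges huw).symm)
    ((hA _ _).1 (c.adj_of_mem_edges hwv)) (fun h ↦ huv (hval h))
  have hsymm : ((φ (φ.symm ⟨w', hw'⟩)) : ℕ) = w' := by rw [φ.apply_symm_apply]
  have hsub : {w, φ.symm ⟨w', hw'⟩} ⊆ {w | G.Adj u w ∧ G.Adj v w} := by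
    rintro _ (rfl | rfl)
    · exact ⟨c.adj_of_mem_edges huw, (c.adj_of_mem_edges hwv).symm⟩
    · exact ⟨(hA _ _).2 (by rwa [hsymm]), (hA _ _).2 (by rwa [hsymm])⟩
  have hcard := Set.ncard_le_ncard hsub
  rwa [Set.ncard_pair] at hcard
  rintro rfl
  exact hne hsymm.symm
end InducedCycle

/-! ### Strict descent and the antichain -/

theorem IsStep.cyclomaticNumber_lt {n : ℕ} (hn : 8 ≤ n) {H G : FinGraph} (h : IsStep H G)
    (φ : G.graph ≃g twoEaredCycle n) :
    cyclomaticNumber H.graph < cyclomaticNumber G.graph := by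
  have := G.finite
  have hK := isKConnected_two_of_iso hn φ
  rcases h with ⟨v, ⟨ψ⟩⟩ | ⟨e, he, ⟨ψ⟩⟩ | ⟨u, v, huv, ⟨ψ⟩⟩
  · rw [cyclomaticNumber_congr ψ]
    refine cyclomaticNumber_induce_ne_lt ?_ (hK.preconnected_induce_ne v)
    obtain ⟨a, b, hab, ha, hb⟩ := exists_two_adj hn φ v
    rw [← Set.ncard_pair hab]
    exact Set.ncard_le_ncard (t := G.graph.neighborSet v) (by rintro _ (rfl | rfl) <;> assumption)
  · rw [cyclomaticNumber_congr ψ]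
    induction e using Sym2.ind with | _ x y
    refine cyclomaticNumber_deleteEdges_lt he ?_
    -- The edge xy is not a bridge: go from x to another neighbour z, then to y inside the connected
    -- graph G - x.
    obtain ⟨z, hz, hxz⟩ : ∃ z, z ≠ y ∧ G.graph.Adj x z := by
      obtain ⟨a, b, hab, ha, hb⟩ := exists_two_adj hn φ x
      by_cases hay : a = y
      · exact ⟨b, fun hby ↦ hab (hay.trans hby.symm), hb⟩
      · exact ⟨a, hay, ha⟩
    have hxy : G.graph.Adj x y := he
    have hr := hK.preconnected_induce_ne x ⟨z, hxz.ne'⟩ ⟨y, hxy.ne'⟩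
    have hzy := reachable_induction
      (P := fun t ↦ (G.graph.deleteEdges {s(x, y)}).Reachable z t.1) hr .rfl (by
        rintro ⟨s, hs⟩ ⟨t, ht⟩ hst hzs
        refine hzs.trans (SimpleGraph.Adj.reachable ?_)
        rw [SimpleGraph.deleteEdges_adj]
        refine ⟨hst, fun h ↦ ?_⟩
        rcases Sym2.eq_iff.1 h with h | h
        exacts [hs h.1, ht h.2])
    refine SimpleGraph.Reachable.trans (SimpleGraph.Adj.reachable ?_) hzy
    rw [SimpleGraph.deleteEdges_adj]
    refine ⟨hxz, fun h ↦ hz (Sym2.congr_right.1 h)⟩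
  · rw [cyclomaticNumber_congr ψ]
    have h1 := cyclomaticNumber_contract_pair_add_le (G := G.graph) huv.1
    have h2 := two_le_card_of_isAdmissible hn φ huv
    omega

/-- Going down from G, the first genuine operation acts on a copy of G and strictly lowers the
cyclomatic number; later ones cannot raise it again. -/
theorem IsBipartiteMinor.iso_or_cyclomaticNumber_lt {n : ℕ} (hn : 8 ≤ n) {H G : FinGraph}
    (h : IsBipartiteMinor H G) (φ : G.graph ≃g twoEaredCycle n) :
    Nonempty (H.graph ≃g G.graph) ∨ cyclomaticNumber H.graph < cyclomaticNumber G.graph := by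
  induction h using Relation.ReflTransGen.head_induction_on with
  | refl => exact Or.inl ⟨SimpleGraph.Iso.refl⟩
  | head hstep _ ih =>
    rcases hstep with ⟨⟨ψ⟩⟩ | hstep
    · rcases ih with ⟨⟨χ⟩⟩ | ih
      · exact Or.inl ⟨ψ.trans χ⟩
      · exact Or.inr ((cyclomaticNumber_congr ψ).trans_lt ih)
    · rcases ih with ⟨⟨χ⟩⟩ | ih
      · exact Or.inr ((hstep.cyclomaticNumber_lt hn (χ.trans φ)).trans_eq
          (cyclomaticNumber_congr χ))
      · exact Or.inr (hstep.cyclomaticNumber_le.trans_lt ih)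

theorem dog_isBipartite {k : ℕ} (he : Even k) (hk : 4 ≤ k) :
    (dog k ![4, 4]).graph.IsBipartite :=
  (twoEaredCycle_isBipartite (by omega) (he.add (by decide))).of_hom (dogIso hk).toHom

theorem dog_isKConnected_two {k : ℕ} (hk : 4 ≤ k) : IsKConnected 2 (dog k ![4, 4]).graph :=
  isKConnected_two_of_iso (by omega) (dogIso hk)

theorem not_isBipartiteMinor_dog {k k' : ℕ} (hk : 4 ≤ k) (hk' : 4 ≤ k') (hne : k ≠ k') :
    ¬ IsBipartiteMinor (dog k ![4, 4]) (dog k' ![4, 4]) := by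
  intro h
  rcases h.iso_or_cyclomaticNumber_lt (by omega) (dogIso hk') with ⟨⟨φ⟩⟩ | h
  · have := Nat.card_congr (((dogIso hk).symm.trans φ).trans (dogIso hk')).toEquiv
    rw [Nat.card_fin, Nat.card_fin] at this
    omega
  · rw [cyclomaticNumber_of_iso (by omega) (dogIso hk),
      cyclomaticNumber_of_iso (by omega) (dogIso hk')] at h
    exact lt_irrefl _ h

theorem not_wellQuasiOrdered_of_dog {K : FinGraph → Prop}
    (hK : ∀ k : ℕ, Even k → 4 ≤ k → K (dog k ![4, 4])) :
    ¬ WellQuasiOrdered fun H G : {G : FinGraph // K G} ↦ IsBipartiteMinor H.1 G.1 := by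
  intro h
  obtain ⟨i, j, hij, h⟩ := h fun i ↦ ⟨dog (2 * i + 4) ![4, 4],
    hK _ ((even_two_mul i).add (by decide)) (by omega)⟩
  exact not_isBipartiteMinor_dog (by omega) (by omega) (by omega) h

end BipMinor

theorem mainTheorem1 :
    -- not a well-quasi-order on all graphs, on bipartite graphs, on 2-connected bipartite graphs
    (¬ WellQuasiOrdered BipMinor.IsBipartiteMinor) ∧
    (¬ WellQuasiOrdered fun H G : {G : BipMinor.FinGraph // G.graph.IsBipartite} =>
        BipMinor.IsBipartiteMinor H.1 G.1) ∧
    (¬ WellQuasiOrdered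
        fun H G : {G : BipMinor.FinGraph //
            G.graph.IsBipartite ∧ BipMinor.IsKConnected 2 G.graph} =>
          BipMinor.IsBipartiteMinor H.1 G.1) ∧
    -- the graphs `D(k, 4, 4)`, `k ≥ 4` even, are bipartite, 2-connected, pairwise incomparable
    (∀ k : ℕ, Even k → 4 ≤ k →
      (BipMinor.dog k ![4, 4]).graph.IsBipartite ∧
      BipMinor.IsKConnected 2 (BipMinor.dog k ![4, 4]).graph) ∧
    (∀ k k' : ℕ, Even k → Even k' → 4 ≤ k → 4 ≤ k' → k ≠ k' →
      ¬ BipMinor.IsBipartiteMinor (BipMinor.dog k ![4, 4]) (BipMinor.dog k' ![4, 4])) := by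
  refine ⟨fun h ↦ ?_, BipMinor.not_wellQuasiOrdered_of_dog fun k he hk ↦
    BipMinor.dog_isBipartite he hk, BipMinor.not_wellQuasiOrdered_of_dog fun k he hk ↦
    ⟨BipMinor.dog_isBipartite he hk, BipMinor.dog_isKConnected_two hk⟩, fun k he hk ↦
    ⟨BipMinor.dog_isBipartite he hk, BipMinor.dog_isKConnected_two hk⟩, fun k k' _ _ hk hk' hne ↦
    BipMinor.not_isBipartiteMinor_dog hk hk' hne⟩
  -- Incomparability does not depend on parity, so among all graphs every length from 4 on may be
  -- used.
  obtain ⟨i, j, hij, h⟩ := h fun i ↦ BipMinor.dog (i + 4) ![4, 4]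
  exact BipMinor.not_isBipartiteMinor_dog (by omega) (by omega) (by omega) h
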